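/- **Theorem (Signal recovery).** Let $\mathbb K$ be $\mathbb R$ or $\mathbb C$. *Setup.* Let $\mathcal T\subseteq\mathbb R^n$ be a union of $M$ linear subspaces, each of dimension at most $\ell$, and let $\mathcal Q\subseteq\mathbb R^n$ satisfy $\mathcal Q-\mathcal Q\subseteq\mathcal T$. Let $F\in\mathbb K^{n\times n}$ be unitary, and let $\boldsymbol\alpha\in\mathbb R_+^n$ be its vector of local coherences, $\alpha_j=\sup\{|(F\boldsymbol x)_j| : \boldsymbol x\in\mathcal T,\ \|\boldsymbol x\|_2\le 1\}$. Let $S\in\mathbb R^{m\times n}$ be a deterministic sampling matrix, i.e. its $i$-th row is $\sqrt{n/m}\,\boldsymbol e_{j_i}$ for some $j_i\in\{1,\dots,n\}$. Let $\boldsymbol d\in\mathbb R^n$ have non-negative entries, put $D=\mathrm{Diag}(\boldsymbol d)$, and let $\widetilde D=\sqrt{m/n}\,\mathrm{Diag}(S\boldsymbol d)=\mathrm{Diag}(d_{j_1},\dots,d_{j_m})$, so that $\widetilde DS=SD$. Assume that the rows of $S$ are ordered so that the entries of $S\boldsymbol d$ are non-increasing, and that $SDF$ has the restricted isometry property on $\mathcal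 T$: $\big|\|SDF\boldsymbol u\|_2-1\big|\le\frac13$ for all $\boldsymbol u\in\mathcal T$ with $\|\boldsymbol u\|_2=1$. For $\boldsymbol v\in\mathbb R^m$ let $I$ be the least index with $\sum_{j\le I}v_j^2\ge1$, and let $\mathbb T(\boldsymbol v)\in\mathbb R^m$ have entries $v_i$ for $i<I$, $\big(1-\sum_{j<I}v_j^2\big)^{1/2}$ for $i=I$, and $0$ for $i>I$; if there is no such index, i.e. if $\|\boldsymbol v\|_2<1$, let $\mathbb T(\boldsymbol v)=\boldsymbol v$. Let $\sigma\ge 0$ and let $\boldsymbol g\sim\mathcal N(0,I_m)$ be a Gaussian vector in $\mathbb K^m$: its entries are independent and $\mathcal N(0,1)$ if $\mathbb K=\mathbb R$; if $\mathbb K=\mathbb C$, all their real and imaginary parts are independent and $\mathcal N(0,1)$. For $\boldsymbol x_0\in\mathbb R^n$ let $\boldsymbol b=SF\boldsymbol x_0+\frac{\sigma}{\sqrt m}\boldsymbol g$. *Conclusion.* For every $t>0$, with probability at least $1-2e^{-t^2}$ over $\boldsymbol g$, the following holds. For every $\boldsymbol x_0\in\mathbb R^n$, every point $\boldsymbol p$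 of $\mathcal Q$ nearest to $\boldsymbol x_0$ in the Euclidean norm, with $\boldsymbol x^\perp=\boldsymbol x_0-\boldsymbol p$, every $\varepsilon>0$ and every $\hat{\boldsymbol x}\in\mathcal Q$ with $$\|\widetilde DSF\hat{\boldsymbol x}-\widetilde D\boldsymbol b\|_2^2\le\inf_{\boldsymbol x\in\mathcal Q}\|\widetilde DSF\boldsymbol x-\widetilde D\boldsymbol b\|_2^2+\varepsilon,$$ one has $$\|\hat{\boldsymbol x}-\boldsymbol x_0\|_2\le 9\,\frac{\sigma}{\sqrt m}\,\|\widetilde D\,\mathbb T(SD\boldsymbol\alpha)\|_2\left(\sqrt\ell+\sqrt{\log M}+t\right)+\|\boldsymbol x^\perp\|_2+6\,\|SDF\boldsymbol x^\perp\|_2+\tfrac32\sqrt\varepsilon .$$ -/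

import Mathlib

open MeasureTheory ProbabilityTheory
open scoped Pointwise

noncomputable section

namespace SubsampledUnitary

/-- The canonical embedding of `ℝⁿ` in `𝕜ⁿ`, where `𝕜` is `ℝ` or `ℂ`. -/
def embed (𝕜 : Type*) [RCLike 𝕜] {n : ℕ} (x : EuclideanSpace ℝ (Fin n)) :
    EuclideanSpace 𝕜 (Fin n) :=
  WithLp.toLp 2 fun i => (x i : 𝕜)

/-- A real matrix, viewed as a matrix over `𝕜`. -/
def realMat (𝕜 : Type*) [RCLike 𝕜] {m n : ℕ} (A : Matrix (Fin m) (Fin n) ℝ) :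
    Matrix (Fin m) (Fin n) 𝕜 :=
  A.map fun a => (a : 𝕜)

/-- Matrix-vector product `A x`, between Euclidean spaces. -/
def app {𝕜 : Type*} [RCLike 𝕜] {m n : ℕ} (A : Matrix (Fin m) (Fin n) 𝕜)
    (x : EuclideanSpace 𝕜 (Fin n)) : EuclideanSpace 𝕜 (Fin m) :=
  WithLp.toLp 2 (A.mulVec x.ofLp)

/-- Local coherence `sup {|φ* x| : x ∈ T, ‖x‖₂ ≤ 1}` of `φ ∈ 𝕜ⁿ` with respect to `T ⊆ ℝⁿ ⊆ 𝕜ⁿ`. -/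
def localCoherence {𝕜 : Type*} [RCLike 𝕜] {n : ℕ} (T : Set (EuclideanSpace ℝ (Fin n)))
    (φ : EuclideanSpace 𝕜 (Fin n)) : ℝ :=
  sSup ((fun x => ‖inner 𝕜 φ (embed 𝕜 x)‖) '' (T ∩ Metric.closedBall 0 1))

/-- The `j`-th row vector `f_j` of `F`, with the convention `F = ∑ⱼ e_j f_j*`. -/
def rowVec {𝕜 : Type*} [RCLike 𝕜] {n : ℕ} (F : Matrix (Fin n) (Fin n) 𝕜) (j : Fin n) :
    EuclideanSpace 𝕜 (Fin n) :=
  WithLp.toLp 2 fun i => star (F j i)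

/-- The vector `α` of local coherences of the rows of `F` with respect to `T`. -/
def localCoherences {𝕜 : Type*} [RCLike 𝕜] {n : ℕ} (F : Matrix (Fin n) (Fin n) 𝕜)
    (T : Set (EuclideanSpace ℝ (Fin n))) : Fin n → ℝ :=
  fun j => localCoherence T (rowVec F j)

/-- `S` is a sampling matrix: every row is `√(n/m) e_j` for some `j`. -/
def IsSamplingMatrix {m n : ℕ} (S : Matrix (Fin m) (Fin n) ℝ) : Prop :=
  ∀ i, ∃ j, S i = Real.sqrt ((n : ℝ) / m) • Pi.single j 1

/-- The diagonal preconditioner `D̃ = √(m/n) Diag(S d)` on `ℝᵐ`. The factor removes the normalization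
`√(n/m)` of the rows of `S`: if row `i` of `S` is `√(n/m) e_j`, the `i`-th diagonal entry is `d_j`,
so that `D̃ S = S D` with `D = Diag(d)` (see `precond_mul`). -/
def precond {m n : ℕ} (S : Matrix (Fin m) (Fin n) ℝ) (d : Fin n → ℝ) :
    Matrix (Fin m) (Fin m) ℝ :=
  Matrix.diagonal fun i => Real.sqrt ((m : ℝ) / n) * S.mulVec d i

theorem precond_mul {m n : ℕ} {S : Matrix (Fin m) (Fin n) ℝ} (hS : IsSamplingMatrix S)
    (d : Fin n → ℝ) : precond S d * S = S * Matrix.diagonal d := by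
  ext i k
  obtain ⟨j, hj⟩ := hS i
  have hm : (0 : ℝ) < m := by exact_mod_cast i.pos
  have hn : (0 : ℝ) < n := by exact_mod_cast j.pos
  have hc : Real.sqrt ((m : ℝ) / n) * Real.sqrt ((n : ℝ) / m) = 1 := by
    rw [← Real.sqrt_mul (by positivity)]
    simp [hm.ne', hn.ne']
  have h1 : S.mulVec d i = Real.sqrt ((n : ℝ) / m) * d j := by
    rw [Matrix.mulVec, hj, smul_dotProduct, single_dotProduct, one_mul, smul_eq_mul]
  rw [precond, Matrix.diagonal_mul, Matrix.mul_diagonal, h1, ← mul_assoc, hc, one_mul, hj]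
  by_cases h : k = j
  · subst h; simp [mul_comm]
  · simp [h]

/-- Unit truncation. With `I` the least index such that `‖v|_[I]‖₂ ≥ 1`, the `i`-th entry is
`0` for `i > I`, `√(1 - ‖v|_[I-1]‖₂²)` for `i = I`, and `v_i` for `i < I`.
If `‖v‖₂ < 1` there is no such `I` and nothing is truncated. -/
def unitTrunc {m : ℕ} (v : Fin m → ℝ) : EuclideanSpace ℝ (Fin m) :=
  WithLp.toLp 2 fun i =>
    if 1 ≤ ∑ j ∈ Finset.Iio i, v j ^ 2 then 0
    else if 1 ≤ ∑ j ∈ Finset.Iic i, v j ^ 2 then Real.sqrt (1 - ∑ j ∈ Finset.Iio i, v j ^ 2)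
    else v i

/-- Restricted isometry property of `A` on `T ⊆ ℝⁿ`: `|‖A u‖₂ - 1| ≤ 1/3` for unit `u ∈ T`. -/
def HasRIP {𝕜 : Type*} [RCLike 𝕜] {m n : ℕ} (A : Matrix (Fin m) (Fin n) 𝕜)
    (T : Set (EuclideanSpace ℝ (Fin n))) : Prop :=
  ∀ u ∈ T, ‖u‖ = 1 → |‖app A (embed 𝕜 u)‖ - 1| ≤ 1 / 3

/-- The standard Gaussian law on `𝕜`: the law of `a + b I` with `a, b` independent `N(0,1)`.
For `𝕜 = ℝ` one has `I = 0`, which leaves `N(0,1)`; for `𝕜 = ℂ` the real and imaginary parts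
are independent `N(0,1)`. -/
def stdGaussianScalar (𝕜 : Type*) [RCLike 𝕜] : Measure 𝕜 :=
  ((gaussianReal 0 1).prod (gaussianReal 0 1)).map
    fun z : ℝ × ℝ => (z.1 : 𝕜) + (z.2 : 𝕜) * RCLike.I

/-- `g ∼ N(0, I_m)` in `𝕜ᵐ`: the entries are i.i.d. standard Gaussian. -/
def IsStdGaussianVector {𝕜 : Type*} [RCLike 𝕜] {m : ℕ} {Ω : Type*} [MeasurableSpace Ω]
    (g : Ω → EuclideanSpace 𝕜 (Fin m)) (P : Measure Ω) : Prop :=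
  (∀ i, HasLaw (fun ω => g ω i) (stdGaussianScalar 𝕜) P) ∧ iIndepFun (fun i ω => g ω i) P

/-- The measurements `b = S F x₀ + η` with noise `η = σ g / √m`. -/
def measurements {𝕜 : Type*} [RCLike 𝕜] {m n : ℕ} (S : Matrix (Fin m) (Fin n) ℝ)
    (F : Matrix (Fin n) (Fin n) 𝕜) (σ : ℝ) (x₀ : EuclideanSpace ℝ (Fin n))
    (g : EuclideanSpace 𝕜 (Fin m)) : EuclideanSpace 𝕜 (Fin m) :=
  app (realMat 𝕜 S * F) (embed 𝕜 x₀) + ((σ / Real.sqrt m : ℝ) : 𝕜) • g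

/-- `p` is a point of `Q` nearest to `x₀`. -/
def IsNearestPoint {n : ℕ} (Q : Set (EuclideanSpace ℝ (Fin n)))
    (x₀ p : EuclideanSpace ℝ (Fin n)) : Prop :=
  p ∈ Q ∧ ∀ q ∈ Q, ‖x₀ - p‖ ≤ ‖x₀ - q‖

/-- The objective `‖D̃ S F x - D̃ b‖₂²` of the reconstruction problem. -/
def objective {𝕜 : Type*} [RCLike 𝕜] {m n : ℕ} (S : Matrix (Fin m) (Fin n) ℝ)
    (F : Matrix (Fin n) (Fin n) 𝕜) (d : Fin n → ℝ) (b : EuclideanSpace 𝕜 (Fin m))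
    (x : EuclideanSpace ℝ (Fin n)) : ℝ :=
  ‖app (realMat 𝕜 (precond S d) * realMat 𝕜 S * F) (embed 𝕜 x)
    - app (realMat 𝕜 (precond S d)) b‖ ^ 2

/-- `x̂ ∈ Q` minimizes the objective over `Q` up to the additive error `ε`. -/
def IsApproxMinimizer {𝕜 : Type*} [RCLike 𝕜] {m n : ℕ} (Q : Set (EuclideanSpace ℝ (Fin n)))
    (S : Matrix (Fin m) (Fin n) ℝ) (F : Matrix (Fin n) (Fin n) 𝕜) (d : Fin n → ℝ)
    (b : EuclideanSpace 𝕜 (Fin m)) (ε : ℝ) (xhat : EuclideanSpace ℝ (Fin n)) : Prop :=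
  xhat ∈ Q ∧ ∀ x ∈ Q, objective S F d b xhat ≤ objective S F d b x + ε

end SubsampledUnitary

end

/-! Put A = SDF and w = x̂ - p, which lies in T. Comparing the objective at x̂ and at p and
expanding squares gives ‖Aw‖² ≤ 2 Re⟨Aw, Ax^⊥ + η⟩ + ε, where η is the preconditioned noise.
Cauchy-Schwarz handles Ax^⊥, and the restricted isometry property turns ‖w‖ into ‖Aw‖, so all that
remains is a bound on Re⟨Aw, η⟩ linear in ‖w‖ and uniform over T.

Up to the factor σ/√m this term is Re⟨D̃Aw, g⟩, a Gaussian process indexed by M subspaces. On each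
one its supremum over the unit ball is the norm of a Gaussian vector in at most ℓ dimensions, scaled
by a bound for ‖D̃Au‖; `measure_sqrt_sum_sq_ge_le` controls that norm by an exponential moment, and
a union bound costs √(log M).

The scale is found in `norm_app_precond_app_le`. For a unit u in T, the entries of Au are dominated
by SDα while ‖Au‖ ≤ 4/3. Maximizing the D̃-weighted norm under these two constraints is a fractional
knapsack problem, whose greedy solution is the unit truncation
(`sum_sq_mul_le_sum_sq_mul_unitTrunc`). -/

namespace SubsampledUnitary

/-! ### Exponential moments and tails of Gaussian vectors. -/

section GaussianMoments

open ENNReal (ofReal)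

theorem lintegral_pi_prod {ι : Type*} [Fintype ι] {X : ι → Type*} [∀ i, MeasurableSpace (X i)]
    (μ : ∀ i, Measure (X i)) [∀ i, IsProbabilityMeasure (μ i)] {f : ∀ i, X i → ENNReal}
    (hf : ∀ i, Measurable (f i)) :
    ∫⁻ x, ∏ i, f i (x i) ∂Measure.pi μ = ∏ i, ∫⁻ x, f i x ∂μ i := by
  have hind : iIndepFun (fun i (x : ∀ i, X i) => f i (x i)) (Measure.pi μ) :=
    iIndepFun_pi fun i => (hf i).aemeasurable
  rw [lintegral_prod_eq_prod_lintegral_of_indepFun _ _ hind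
    fun i => (hf i).comp (measurable_pi_apply i)]
  refine Finset.prod_congr rfl fun i _ => ?_
  exact (measurePreserving_eval μ i).lintegral_comp (hf i)

theorem lintegral_exp_mul_gaussianReal (a : ℝ) :
    ∫⁻ x, ofReal (Real.exp (a * x)) ∂gaussianReal 0 1 = ofReal (Real.exp (a ^ 2 / 2)) := by
  rw [← ofReal_integral_eq_lintegral_ofReal (integrable_exp_mul_gaussianReal a)
    (ae_of_all _ fun x => (Real.exp_pos _).le)]
  have h := congrFun (mgf_id_gaussianReal (μ := 0) (v := 1)) a
  simp only [mgf, id, zero_mul, zero_add, NNReal.coe_one, one_mul] at h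
  rw [h]

theorem lintegral_exp_mul_sq_gaussianReal {c : ℝ} (hc : c < 1 / 2) :
    ∫⁻ x, ofReal (Real.exp (c * x ^ 2)) ∂gaussianReal 0 1 = ofReal (√(1 - 2 * c))⁻¹ := by
  have hb : 0 < 1 / 2 - c := by linarith
  have hprod : ∀ x : ℝ, gaussianPDFReal 0 1 x * Real.exp (c * x ^ 2)
      = (√(2 * Real.pi))⁻¹ * Real.exp (-(1 / 2 - c) * x ^ 2) := fun x => by
    simp only [gaussianPDFReal, NNReal.coe_one, mul_one, sub_zero]
    rw [mul_assoc, ← Real.exp_add]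
    ring_nf
  rw [gaussianReal_of_var_ne_zero _ one_ne_zero,
    lintegral_withDensity_eq_lintegral_mul _ (measurable_gaussianPDF 0 1) (by fun_prop)]
  have h1 : ∀ x : ℝ, (gaussianPDF 0 1 * fun x => ofReal (Real.exp (c * x ^ 2))) x
      = ofReal ((√(2 * Real.pi))⁻¹ * Real.exp (-(1 / 2 - c) * x ^ 2)) := fun x => by
    rw [Pi.mul_apply, gaussianPDF, ← ENNReal.ofReal_mul (gaussianPDFReal_nonneg _ _ _), hprod]
  simp_rw [h1]
  rw [← ofReal_integral_eq_lintegral_ofReal ((integrable_exp_neg_mul_sq hb).const_mul _)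
    (ae_of_all _ fun x => by positivity), integral_const_mul, integral_gaussian]
  congr 1
  rw [← Real.sqrt_inv, ← Real.sqrt_mul (by positivity), ← Real.sqrt_inv]
  congr 1
  have := Real.pi_pos
  field_simp

variable {𝕜 : Type*} [RCLike 𝕜]

instance : IsProbabilityMeasure (stdGaussianScalar 𝕜) :=
  Measure.isProbabilityMeasure_map (by fun_prop)

theorem lintegral_exp_re_inner_stdGaussianScalar (y : 𝕜) :
    ∫⁻ z, ofReal (Real.exp (RCLike.re (inner 𝕜 y z))) ∂stdGaussianScalar 𝕜
      = ofReal (Real.exp (‖y‖ ^ 2 / 2)) := by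
  rw [stdGaussianScalar, lintegral_map (by fun_prop) (by fun_prop)]
  have h : ∀ z : ℝ × ℝ, ofReal (Real.exp (RCLike.re
      (inner 𝕜 y ((z.1 : 𝕜) + (z.2 : 𝕜) * RCLike.I))))
      = ofReal (Real.exp (RCLike.re y * z.1)) * ofReal (Real.exp (RCLike.im y * z.2)) := by
    intro z
    rw [← ENNReal.ofReal_mul (Real.exp_pos _).le, ← Real.exp_add]
    congr 2
    -- The identity `im y * im I = im y` covers both fields at once; over ℝ both sides vanish.
    have h1 := RCLike.I_im' y
    simp [RCLike.inner_apply]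
    linear_combination z.2 * h1
  simp_rw [h]
  rw [lintegral_prod_mul (f := fun x => ofReal (Real.exp (RCLike.re y * x)))
    (g := fun x => ofReal (Real.exp (RCLike.im y * x))) (by fun_prop) (by fun_prop),
    lintegral_exp_mul_gaussianReal,
    lintegral_exp_mul_gaussianReal, ← ENNReal.ofReal_mul (Real.exp_pos _).le, ← Real.exp_add,
    ← RCLike.normSq_eq_def', RCLike.normSq_apply]
  ring_nf

theorem lintegral_exp_re_inner_pi_stdGaussianScalar {m : ℕ} (y : EuclideanSpace 𝕜 (Fin m)) :
    ∫⁻ z, ofReal (Real.exp (RCLike.re (inner 𝕜 y (WithLp.toLp 2 z))))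
        ∂Measure.pi (fun _ : Fin m => stdGaussianScalar 𝕜)
      = ofReal (Real.exp (‖y‖ ^ 2 / 2)) := by
  have h : ∀ z : Fin m → 𝕜, ofReal (Real.exp (RCLike.re (inner 𝕜 y (WithLp.toLp 2 z))))
      = ∏ i, ofReal (Real.exp (RCLike.re (inner 𝕜 (y i) (z i)))) := fun z => by
    rw [← ENNReal.ofReal_prod_of_nonneg fun i _ => (Real.exp_pos _).le, ← Real.exp_sum,
      PiLp.inner_apply, map_sum]
  simp_rw [h]
  rw [lintegral_pi_prod (fun _ : Fin m => stdGaussianScalar 𝕜)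
    (f := fun i z => ofReal (Real.exp (RCLike.re (inner 𝕜 (y i) z)))) (fun i => by fun_prop)]
  simp_rw [lintegral_exp_re_inner_stdGaussianScalar]
  rw [← ENNReal.ofReal_prod_of_nonneg fun i _ => (Real.exp_pos _).le, ← Real.exp_sum,
    EuclideanSpace.norm_sq_eq, Finset.sum_div]

/-- Exponential moment of a quadratic form in a Gaussian vector, by linearizing the square with an
independent real Gaussian vector. -/
theorem lintegral_exp_sum_sq_le {m k : ℕ} (y : Fin k → EuclideanSpace 𝕜 (Fin m))
    (hy : ∀ h : Fin k → ℝ, ‖∑ j, (h j : 𝕜) • y j‖ ^ 2 ≤ ∑ j, h j ^ 2) {c : ℝ} (hc0 : 0 ≤ c)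
    (hc : c < 1 / 2) :
    ∫⁻ z, ofReal (Real.exp (c * ∑ j, RCLike.re (inner 𝕜 (y j) (WithLp.toLp 2 z)) ^ 2))
        ∂Measure.pi (fun _ : Fin m => stdGaussianScalar 𝕜)
      ≤ ofReal ((√(1 - 2 * c))⁻¹ ^ k) := by
  set γ := Measure.pi (fun _ : Fin m => stdGaussianScalar 𝕜)
  set ν := Measure.pi (fun _ : Fin k => gaussianReal 0 1)
  have hlin : ∀ z : Fin m → 𝕜,
      ofReal (Real.exp (c * ∑ j, RCLike.re (inner 𝕜 (y j) (WithLp.toLp 2 z)) ^ 2))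
      = ∫⁻ h, ofReal (Real.exp (RCLike.re
          (inner 𝕜 (∑ j, ((√(2 * c) * h j : ℝ) : 𝕜) • y j) (WithLp.toLp 2 z)))) ∂ν := by
    intro z
    have h1 : ∀ h : Fin k → ℝ, ofReal (Real.exp (RCLike.re
          (inner 𝕜 (∑ j, ((√(2 * c) * h j : ℝ) : 𝕜) • y j) (WithLp.toLp 2 z))))
        = ∏ j, ofReal (Real.exp
          (√(2 * c) * RCLike.re (inner 𝕜 (y j) (WithLp.toLp 2 z)) * h j)) := fun h => by
      rw [← ENNReal.ofReal_prod_of_nonneg fun i _ => (Real.exp_pos _).le, ← Real.exp_sum,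
        sum_inner, map_sum]
      congr 2
      refine Finset.sum_congr rfl fun j _ => ?_
      rw [inner_smul_left, RCLike.conj_ofReal, RCLike.re_ofReal_mul]
      ring
    simp_rw [h1]
    rw [lintegral_pi_prod (fun _ : Fin k => gaussianReal 0 1) (f := fun j x => ofReal (Real.exp
          (√(2 * c) * RCLike.re (inner 𝕜 (y j) (WithLp.toLp 2 z)) * x))) (fun i => by fun_prop)]
    simp_rw [lintegral_exp_mul_gaussianReal]
    rw [← ENNReal.ofReal_prod_of_nonneg fun i _ => (Real.exp_pos _).le, ← Real.exp_sum,
      Finset.mul_sum]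
    congr 2
    refine Finset.sum_congr rfl fun j _ => ?_
    rw [mul_pow, Real.sq_sqrt (by positivity)]
    ring
  simp_rw [hlin]
  -- Tonelli: integrating over z first leaves a Gaussian integral in h, where the contraction
  -- hypothesis applies.
  rw [lintegral_lintegral_swap (by
    refine Measurable.aemeasurable ?_
    simp only [Function.uncurry_def]
    fun_prop)]
  simp_rw [γ, lintegral_exp_re_inner_pi_stdGaussianScalar]
  calc ∫⁻ h, ofReal (Real.exp (‖∑ j, ((√(2 * c) * h j : ℝ) : 𝕜) • y j‖ ^ 2 / 2)) ∂ν
      ≤ ∫⁻ h, ∏ j, ofReal (Real.exp (c * h j ^ 2)) ∂ν := by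
        refine lintegral_mono fun h => ?_
        rw [← ENNReal.ofReal_prod_of_nonneg fun i _ => (Real.exp_pos _).le, ← Real.exp_sum]
        refine ENNReal.ofReal_le_ofReal (Real.exp_le_exp.2 ?_)
        have := hy fun j => √(2 * c) * h j
        simp_rw [mul_pow, Real.sq_sqrt (show 0 ≤ 2 * c by positivity)] at this
        rw [← Finset.mul_sum] at this ⊢
        linarith
    _ = ofReal ((√(1 - 2 * c))⁻¹ ^ k) := by
        rw [lintegral_pi_prod (fun _ : Fin k => gaussianReal 0 1)
          (f := fun j x => ofReal (Real.exp (c * x ^ 2))) (fun i => by fun_prop)]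
        simp_rw [lintegral_exp_mul_sq_gaussianReal hc]
        rw [Finset.prod_const, Finset.card_univ, Fintype.card_fin,
          ENNReal.ofReal_pow (by positivity)]

/-- Concentration of the norm of a contraction of a Gaussian vector to `ℝᵏ`. -/
theorem measure_sqrt_sum_sq_ge_le {m k : ℕ} (y : Fin k → EuclideanSpace 𝕜 (Fin m))
    (hy : ∀ h : Fin k → ℝ, ‖∑ j, (h j : 𝕜) • y j‖ ^ 2 ≤ ∑ j, h j ^ 2) {τ : ℝ} (hτ : 0 < τ) :
    Measure.pi (fun _ : Fin m => stdGaussianScalar 𝕜)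
        {z | √k + τ ≤ √(∑ j, RCLike.re (inner 𝕜 (y j) (WithLp.toLp 2 z)) ^ 2)}
      ≤ ofReal (Real.exp (-τ ^ 2 / 2)) := by
  -- Dimension zero is separate because the Chernoff parameter below divides by √k.
  rcases Nat.eq_zero_or_pos k with rfl | hk
  · have : {z : Fin m → 𝕜 | √((0 : ℕ) : ℝ) + τ
        ≤ √(∑ j, RCLike.re (inner 𝕜 (y j) (WithLp.toLp 2 z)) ^ 2)} = ∅ := by
      ext z; simp [hτ]
    rw [this, measure_empty]
    exact zero_le
  set s := √(k : ℝ) with hs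
  have hs0 : 0 < s := Real.sqrt_pos.2 (by exact_mod_cast hk)
  have hsk : s ^ 2 = k := Real.sq_sqrt (by positivity)
  set R := s + τ with hR
  have hR0 : 0 < R := by positivity
  -- The minimizer of the Chernoff exponent -c R² - (k/2) log(1 - 2c).
  set c : ℝ := (1 - (s / R) ^ 2) / 2 with hcdef
  have hq : s / R < 1 := (div_lt_one hR0).2 (by linarith)
  have hq0 : 0 < s / R := by positivity
  have hc0 : 0 ≤ c := by
    have : (s / R) ^ 2 ≤ 1 := pow_le_one₀ hq0.le hq.le
    rw [hcdef]; linarith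
  have hc : c < 1 / 2 := by
    have : 0 < (s / R) ^ 2 := by positivity
    rw [hcdef]; linarith
  have hroot : √(1 - 2 * c) = s / R := by
    rw [show 1 - 2 * c = (s / R) ^ 2 by rw [hcdef]; ring, Real.sqrt_sq hq0.le]
  have hmom := lintegral_exp_sum_sq_le y hy hc0 hc
  rw [hroot, inv_div] at hmom
  have hpow : (R / s) ^ k ≤ Real.exp (s * τ) := by
    have h1 : R / s ≤ Real.exp (τ / s) := by
      have := Real.add_one_le_exp (τ / s)
      rwa [show τ / s + 1 = R / s by rw [hR]; field_simp; ring] at this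
    calc (R / s) ^ k ≤ Real.exp (τ / s) ^ k := pow_le_pow_left₀ (by positivity) h1 k
      _ = Real.exp (s * τ) := by
        rw [← Real.exp_nat_mul, ← hsk]
        congr 1
        field_simp
  have hcR : c * R ^ 2 = s * τ + τ ^ 2 / 2 := by
    rw [hcdef]
    field_simp
    rw [hR]
    ring
  set γ := Measure.pi (fun _ : Fin m => stdGaussianScalar 𝕜)
  refine (meas_le_lintegral₀ (f := fun z => ofReal (Real.exp (-(c * R ^ 2))) * ofReal (Real.exp
    (c * ∑ j, RCLike.re (inner 𝕜 (y j) (WithLp.toLp 2 z)) ^ 2))) (by fun_prop) ?_).trans ?_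
  · intro z hz
    rw [← ENNReal.ofReal_mul (Real.exp_pos _).le, ← Real.exp_add, ENNReal.one_le_ofReal,
      Real.one_le_exp_iff]
    have h2 := (Real.le_sqrt' hR0).1 hz
    have := mul_le_mul_of_nonneg_left h2 hc0
    linarith
  · rw [lintegral_const_mul _ (by fun_prop)]
    calc _ ≤ ofReal (Real.exp (-(c * R ^ 2))) * ofReal (Real.exp (s * τ)) := by
          gcongr
          exact hmom.trans (ENNReal.ofReal_le_ofReal hpow)
      _ = _ := by
          rw [← ENNReal.ofReal_mul (Real.exp_pos _).le, ← Real.exp_add, hcR]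
          ring_nf

end GaussianMoments

/-! ### Optimality of the unit truncation. -/

section Truncation

/-- A unit budget with capacities v_i² is best spent on the largest weights, which come first; the
truncation does exactly this, stopping inside the cell I where the budget runs out. -/
theorem sum_sq_mul_le_sum_sq_mul_unitTrunc {m : ℕ} {w v a : Fin m → ℝ} (hw : Antitone w)
    (hw0 : ∀ i, 0 ≤ w i) (ha0 : ∀ i, 0 ≤ a i) (hav : ∀ i, a i ≤ v i ^ 2) (ha : ∑ i, a i ≤ 1) :
    ∑ i, w i ^ 2 * a i ≤ ∑ i, w i ^ 2 * unitTrunc v i ^ 2 := by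
  by_cases hv : ∃ i, 1 ≤ ∑ j ∈ Finset.Iic i, v j ^ 2
  swap
  · push Not at hv
    have hlt : ∀ i, ∑ j ∈ Finset.Iio i, v j ^ 2 < 1 := fun i =>
      (Finset.sum_le_sum_of_subset_of_nonneg Finset.Iio_subset_Iic_self
        fun _ _ _ => sq_nonneg _).trans_lt (hv i)
    refine Finset.sum_le_sum fun i _ => mul_le_mul_of_nonneg_left ?_ (sq_nonneg _)
    simp only [unitTrunc, not_le.2 (hv i), not_le.2 (hlt i), if_false]
    exact hav i
  obtain ⟨I, hI, hmin⟩ := WellFounded.has_min (wellFounded_lt (α := Fin m))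
    {i | 1 ≤ ∑ j ∈ Finset.Iic i, v j ^ 2} hv
  have hIic : ∀ i < I, ∑ j ∈ Finset.Iic i, v j ^ 2 < 1 := fun i hi =>
    not_le.1 fun h => hmin i h hi
  -- Indices below i are those up to its predecessor, which is less than I.
  have hIio : ∀ i ≤ I, ∑ j ∈ Finset.Iio i, v j ^ 2 < 1 := by
    intro i hi
    by_contra! h
    rcases (Finset.Iio i).eq_empty_or_nonempty with h0 | h0
    · rw [h0] at h; norm_num at h
    · set k := (Finset.Iio i).max' h0
      have hk : k < i := Finset.mem_Iio.1 (Finset.max'_mem _ h0)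
      have hsub : Finset.Iio i ⊆ Finset.Iic k := fun j hj =>
        Finset.mem_Iic.2 (Finset.le_max' _ _ hj)
      exact absurd (h.trans (Finset.sum_le_sum_of_subset_of_nonneg hsub fun _ _ _ => sq_nonneg _))
        (not_le.2 (hIic k (hk.trans_le hi)))
  have hgt : ∀ i, I < i → 1 ≤ ∑ j ∈ Finset.Iio i, v j ^ 2 := fun i hi =>
    hI.trans (Finset.sum_le_sum_of_subset_of_nonneg
      (fun j hj => Finset.mem_Iio.2 ((Finset.mem_Iic.1 hj).trans_lt hi)) fun _ _ _ => sq_nonneg _)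
  have tlt : ∀ i < I, unitTrunc v i ^ 2 = v i ^ 2 := fun i hi => by
    simp [unitTrunc, not_le.2 (hIio i hi.le), not_le.2 (hIic i hi)]
  have tgt : ∀ i, I < i → unitTrunc v i = 0 := fun i hi => by
    simp [unitTrunc, hgt i hi]
  have teq : unitTrunc v I ^ 2 = 1 - ∑ j ∈ Finset.Iio I, v j ^ 2 := by
    have h1 : 1 ≤ ∑ j ∈ Finset.Iic I, v j ^ 2 := hI
    have h2 := hIio I le_rfl
    simp only [unitTrunc, not_le.2 h2, h1, if_false, if_true]
    exact Real.sq_sqrt (by linarith)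
  have tsum : ∑ i, unitTrunc v i ^ 2 = 1 := by
    rw [← Finset.sum_subset (Finset.subset_univ (Finset.Iic I)) fun i _ hi => by
      rw [tgt i (not_le.1 fun h => hi (Finset.mem_Iic.2 h))]; norm_num]
    rw [← Finset.Iio_insert, Finset.sum_insert (by simp), teq,
      Finset.sum_congr rfl fun i hi => tlt i (Finset.mem_Iio.1 hi)]
    ring
  -- Exchange argument: before I the weight is larger and the greedy choice dominates a; after I
  -- both comparisons reverse. So w_I² can replace every weight, and the total budgets decide.
  have key : ∀ i, w I ^ 2 * (unitTrunc v i ^ 2 - a i) ≤ w i ^ 2 * (unitTrunc v i ^ 2 - a i) := by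
    intro i
    rcases lt_trichotomy i I with hi | rfl | hi
    · rw [tlt i hi]
      exact mul_le_mul_of_nonneg_right (pow_le_pow_left₀ (hw0 _) (hw hi.le) 2)
        (sub_nonneg.2 (hav i))
    · exact le_rfl
    · rw [tgt i hi]
      exact mul_le_mul_of_nonpos_right (pow_le_pow_left₀ (hw0 _) (hw hi.le) 2)
        (by have := ha0 i; linarith)
  have := Finset.sum_le_sum fun i (_ : i ∈ Finset.univ) => key i
  rw [← Finset.mul_sum, Finset.sum_sub_distrib, tsum] at this
  simp_rw [mul_sub] at this
  rw [Finset.sum_sub_distrib] at this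
  have h0 : 0 ≤ w I ^ 2 * (1 - ∑ i, a i) := mul_nonneg (sq_nonneg _) (by linarith)
  linarith

end Truncation

/-! ### Linear maps, local coherences and restricted isometry. -/

section Operators

variable {𝕜 : Type*} [RCLike 𝕜] {m n : ℕ}

theorem app_add (A : Matrix (Fin m) (Fin n) 𝕜) (x y : EuclideanSpace 𝕜 (Fin n)) :
    app A (x + y) = app A x + app A y := by
  simp [app, Matrix.mulVec_add]

theorem app_sub (A : Matrix (Fin m) (Fin n) 𝕜) (x y : EuclideanSpace 𝕜 (Fin n)) :
    app A (x - y) = app A x - app A y := by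
  simp [app, Matrix.mulVec_sub]

theorem app_smul (A : Matrix (Fin m) (Fin n) 𝕜) (c : 𝕜) (x : EuclideanSpace 𝕜 (Fin n)) :
    app A (c • x) = c • app A x := by
  simp [app, Matrix.mulVec_smul]

theorem app_mul {k : ℕ} (A : Matrix (Fin k) (Fin m) 𝕜) (B : Matrix (Fin m) (Fin n) 𝕜)
    (x : EuclideanSpace 𝕜 (Fin n)) : app (A * B) x = app A (app B x) := by
  simp [app, Matrix.mulVec_mulVec]

theorem embed_sub (x y : EuclideanSpace ℝ (Fin n)) :
    embed 𝕜 (x - y) = embed 𝕜 x - embed 𝕜 y := by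
  ext i; simp [embed]

theorem embed_sum_smul {ι : Type*} (s : Finset ι) (h : ι → ℝ)
    (x : ι → EuclideanSpace ℝ (Fin n)) :
    embed 𝕜 (∑ j ∈ s, h j • x j) = ∑ j ∈ s, (h j : 𝕜) • embed 𝕜 (x j) := by
  ext i; simp [embed]

theorem embed_smul (c : ℝ) (x : EuclideanSpace ℝ (Fin n)) :
    embed 𝕜 (c • x) = (c : 𝕜) • embed 𝕜 x := by
  ext i; simp [embed]

theorem norm_embed (x : EuclideanSpace ℝ (Fin n)) : ‖embed 𝕜 x‖ = ‖x‖ := by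
  simp [EuclideanSpace.norm_eq, embed]

theorem app_sum {ι : Type*} (A : Matrix (Fin m) (Fin n) 𝕜) (s : Finset ι)
    (x : ι → EuclideanSpace 𝕜 (Fin n)) : app A (∑ j ∈ s, x j) = ∑ j ∈ s, app A (x j) := by
  classical
  induction s using Finset.induction_on with
  | empty => simp [app]
  | insert a s ha ih => rw [Finset.sum_insert ha, Finset.sum_insert ha, app_add, ih]

theorem realMat_mul {k : ℕ} (A : Matrix (Fin k) (Fin m) ℝ) (B : Matrix (Fin m) (Fin n) ℝ) :
    realMat 𝕜 (A * B) = realMat 𝕜 A * realMat 𝕜 B := by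
  ext i j; simp [realMat, Matrix.mul_apply]

theorem app_realMat_diagonal_apply (w : Fin m → ℝ) (z : EuclideanSpace 𝕜 (Fin m)) (i : Fin m) :
    app (realMat 𝕜 (Matrix.diagonal w)) z i = (w i : 𝕜) * z i := by
  have : realMat 𝕜 (Matrix.diagonal w) = Matrix.diagonal fun i => (w i : 𝕜) := by
    ext i j
    by_cases h : i = j
    · subst h; simp [realMat]
    · simp [realMat, h]
  rw [app, this]
  simp [Matrix.mulVec_diagonal]

theorem inner_app_realMat_diagonal (w : Fin m → ℝ) (x y : EuclideanSpace 𝕜 (Fin m)) :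
    inner 𝕜 x (app (realMat 𝕜 (Matrix.diagonal w)) y)
      = inner 𝕜 (app (realMat 𝕜 (Matrix.diagonal w)) x) y := by
  rw [PiLp.inner_apply, PiLp.inner_apply]
  refine Finset.sum_congr rfl fun i _ => ?_
  rw [app_realMat_diagonal_apply, app_realMat_diagonal_apply]
  simp only [RCLike.inner_apply, map_mul, RCLike.conj_ofReal]
  ring

theorem norm_app_mul_embed_le_localCoherences {T : Set (EuclideanSpace ℝ (Fin n))}
    (F : Matrix (Fin n) (Fin n) 𝕜) {u : EuclideanSpace ℝ (Fin n)} (hu : u ∈ T) (hu1 : ‖u‖ ≤ 1)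
    (j : Fin n) : ‖app F (embed 𝕜 u) j‖ ≤ localCoherences F T j := by
  have hin : ∀ x : EuclideanSpace ℝ (Fin n),
      inner 𝕜 (rowVec F j) (embed 𝕜 x) = app F (embed 𝕜 x) j := by
    intro x
    simp [PiLp.inner_apply, rowVec, app, Matrix.mulVec, dotProduct, mul_comm]
  -- The real `sSup` needs a witness of boundedness; Cauchy-Schwarz supplies the row norm.
  refine le_csSup ⟨‖rowVec F j‖, ?_⟩ ⟨u, ⟨hu, by simpa using hu1⟩, by simp only [hin]⟩
  rintro _ ⟨x, ⟨-, hx⟩, rfl⟩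
  refine (norm_inner_le_norm _ _).trans ?_
  rw [norm_embed]
  exact mul_le_of_le_one_right (norm_nonneg _) (by simpa using hx)

theorem IsSamplingMatrix.norm_app_mul_le {S : Matrix (Fin m) (Fin n) ℝ} (hS : IsSamplingMatrix S)
    {d α : Fin n → ℝ} (hd : ∀ j, 0 ≤ d j) {z : EuclideanSpace 𝕜 (Fin n)}
    (hz : ∀ j, ‖z j‖ ≤ α j) (i : Fin m) :
    ‖app (realMat 𝕜 (S * Matrix.diagonal d)) z i‖ ≤ (S * Matrix.diagonal d).mulVec α i := by
  have hS0 : ∀ j, 0 ≤ S i j := by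
    obtain ⟨k, hk⟩ := hS i
    intro j
    rw [hk]
    by_cases h : j = k
    · subst h; simp; positivity
    · simp [h]
  simp only [app, Matrix.mulVec, dotProduct, realMat, Matrix.map_apply, Matrix.mul_diagonal]
  refine (norm_sum_le _ _).trans (Finset.sum_le_sum fun j _ => ?_)
  rw [norm_mul, RCLike.norm_ofReal, abs_of_nonneg (mul_nonneg (hS0 j) (hd j))]
  exact mul_le_mul_of_nonneg_left (hz j) (mul_nonneg (hS0 j) (hd j))

/-- The restricted isometry property, for vectors of arbitrary norm in a cone. -/
theorem HasRIP.bounds {A : Matrix (Fin m) (Fin n) 𝕜} {T : Set (EuclideanSpace ℝ (Fin n))}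
    (hA : HasRIP A T) (hT : ∀ (c : ℝ), ∀ u ∈ T, c • u ∈ T) {u : EuclideanSpace ℝ (Fin n)}
    (hu : u ∈ T) :
    2 / 3 * ‖u‖ ≤ ‖app A (embed 𝕜 u)‖ ∧ ‖app A (embed 𝕜 u)‖ ≤ 4 / 3 * ‖u‖ := by
  rcases eq_or_ne u 0 with rfl | h
  · have : app A (embed 𝕜 (0 : EuclideanSpace ℝ (Fin n))) = 0 := by
      ext i; simp [app, embed, Matrix.mulVec, dotProduct]
    simp [this]
  have hpos := norm_pos_iff.2 h
  have h1 := hA (‖u‖⁻¹ • u) (hT _ _ hu) (norm_smul_inv_norm h)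
  rw [embed_smul, app_smul, norm_smul, RCLike.norm_ofReal, abs_inv, abs_norm, abs_le,
    inv_mul_eq_div] at h1
  constructor
  · have := h1.1
    have h2 : 2 / 3 ≤ ‖app A (embed 𝕜 u)‖ / ‖u‖ := by linarith
    rwa [le_div_iff₀ hpos] at h2
  · have := h1.2
    have h2 : ‖app A (embed 𝕜 u)‖ / ‖u‖ ≤ 4 / 3 := by linarith
    rwa [div_le_iff₀ hpos] at h2

theorem norm_app_precond_app_le {T : Set (EuclideanSpace ℝ (Fin n))}
    (hT : ∀ (c : ℝ), ∀ u ∈ T, c • u ∈ T) (F : Matrix (Fin n) (Fin n) 𝕜)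
    {S : Matrix (Fin m) (Fin n) ℝ} (hS : IsSamplingMatrix S) {d : Fin n → ℝ} (hd : ∀ j, 0 ≤ d j)
    (hRIP : HasRIP (realMat 𝕜 (S * Matrix.diagonal d) * F) T) (hSd : Antitone (S.mulVec d))
    {u : EuclideanSpace ℝ (Fin n)} (hu : u ∈ T) :
    ‖app (realMat 𝕜 (precond S d)) (app (realMat 𝕜 (S * Matrix.diagonal d) * F) (embed 𝕜 u))‖
      ≤ 4 / 3 * ‖app (precond S d)
          (unitTrunc ((S * Matrix.diagonal d).mulVec (localCoherences F T)))‖ * ‖u‖ := by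
  set A := realMat 𝕜 (S * Matrix.diagonal d) * F with hA
  set v := (S * Matrix.diagonal d).mulVec (localCoherences F T)
  have hS0 : ∀ i, 0 ≤ S.mulVec d i := by
    intro i
    obtain ⟨k, hk⟩ := hS i
    rw [Matrix.mulVec, hk, smul_dotProduct, single_dotProduct, one_mul, smul_eq_mul]
    exact mul_nonneg (Real.sqrt_nonneg _) (hd k)
  have unit : ∀ u ∈ T, ‖u‖ = 1 → ‖app (realMat 𝕜 (precond S d)) (app A (embed 𝕜 u))‖
      ≤ 4 / 3 * ‖app (precond S d) (unitTrunc v)‖ := by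
    intro u hu hu1
    have hAu : ∀ i, ‖app A (embed 𝕜 u) i‖ ≤ v i := by
      intro i
      rw [hA, app_mul]
      exact hS.norm_app_mul_le hd (norm_app_mul_embed_le_localCoherences F hu hu1.le) i
    have hup := (hRIP.bounds hT hu).2
    rw [hu1, mul_one] at hup
    -- Scaling by 3/4 brings ‖Au‖ ≤ 4/3 within the unit budget and keeps the entries below v.
    have hsum : ∑ i, (3 / 4 * ‖app A (embed 𝕜 u) i‖) ^ 2 ≤ 1 := by
      simp_rw [mul_pow]
      rw [← Finset.mul_sum, ← EuclideanSpace.norm_sq_eq]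
      have := pow_le_pow_left₀ (norm_nonneg _) hup 2
      linarith
    have key := sum_sq_mul_le_sum_sq_mul_unitTrunc (v := v)
      (w := fun i => √((m : ℝ) / n) * S.mulVec d i)
      (hSd.const_mul (Real.sqrt_nonneg _)) (fun i => mul_nonneg (Real.sqrt_nonneg _) (hS0 i))
      (a := fun i => (3 / 4 * ‖app A (embed 𝕜 u) i‖) ^ 2) (fun i => sq_nonneg _)
      (fun i => pow_le_pow_left₀ (by positivity)
        (by linarith [hAu i, norm_nonneg (app A (embed 𝕜 u) i)]) 2) hsum
    refine abs_le_of_sq_le_sq' ?_ (by positivity) |>.2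
    rw [mul_pow, EuclideanSpace.norm_sq_eq, EuclideanSpace.norm_sq_eq, precond]
    have hreal : ∀ i, app (Matrix.diagonal fun i => √((m : ℝ) / n) * S.mulVec d i) (unitTrunc v) i
        = √((m : ℝ) / n) * S.mulVec d i * unitTrunc v i := fun i => by
      simp [app, Matrix.mulVec_diagonal]
    simp_rw [app_realMat_diagonal_apply, hreal, norm_mul, mul_pow, RCLike.norm_ofReal,
      Real.norm_eq_abs, sq_abs]
    simp_rw [mul_pow] at key
    calc _ = (4 / 3) ^ 2 * ∑ i, √((m : ℝ) / n) ^ 2 * S.mulVec d i ^ 2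
          * ((3 / 4) ^ 2 * ‖app A (embed 𝕜 u) i‖ ^ 2) := by
          rw [Finset.mul_sum]
          exact Finset.sum_congr rfl fun i _ => by rw [mul_pow]; ring
      _ ≤ _ := by gcongr
  rcases eq_or_ne u 0 with rfl | h
  · have : app (realMat 𝕜 (precond S d)) (app A (embed 𝕜 (0 : EuclideanSpace ℝ (Fin n)))) = 0 := by
      ext i; simp [app, embed, Matrix.mulVec, dotProduct]
    simp [this]
  have h1 := unit (‖u‖⁻¹ • u) (hT _ _ hu) (norm_smul_inv_norm h)
  rw [embed_smul, app_smul, app_smul, norm_smul, RCLike.norm_ofReal, abs_inv, abs_norm,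
    inv_mul_eq_div, div_le_iff₀ (norm_pos_iff.2 h)] at h1
  exact h1

end Operators

/-! ### Uniform control of the noise over a union of subspaces. -/

section Noise

variable {𝕜 : Type*} [RCLike 𝕜] {m n : ℕ}

/-- Tail bound for the supremum of the Gaussian process `⟨C u, z⟩` over the unit ball of a
subspace. -/
theorem measure_exists_re_inner_gt_le (C : Matrix (Fin m) (Fin n) 𝕜)
    (V : Submodule ℝ (EuclideanSpace ℝ (Fin n))) {ℓ : ℕ} (hV : Module.finrank ℝ V ≤ ℓ) {β : ℝ}
    (hβ : 0 ≤ β) (hC : ∀ u ∈ V, ‖app C (embed 𝕜 u)‖ ≤ β * ‖u‖) {τ : ℝ} (hτ : 0 < τ) :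
    Measure.pi (fun _ : Fin m => stdGaussianScalar 𝕜)
        {z | ∃ u ∈ V, β * (√ℓ + τ) * ‖u‖ <
          RCLike.re (inner 𝕜 (app C (embed 𝕜 u)) (WithLp.toLp 2 z))}
      ≤ ENNReal.ofReal (Real.exp (-τ ^ 2 / 2)) := by
  -- For β = 0 the process vanishes; otherwise β⁻¹C sends an orthonormal basis of V to vectors
  -- satisfying the contraction hypothesis.
  rcases hβ.eq_or_lt with rfl | hβ
  · rw [show {z : Fin m → 𝕜 | ∃ u ∈ V, 0 * (√ℓ + τ) * ‖u‖ <
          RCLike.re (inner 𝕜 (app C (embed 𝕜 u)) (WithLp.toLp 2 z))} = ∅ by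
      ext z
      simp only [Set.mem_ofPred_eq, Set.mem_empty_iff_false, iff_false, not_exists, not_and]
      intro u hu
      have : app C (embed 𝕜 u) = 0 := by simpa using hC u hu
      simp [this], measure_empty]
    exact zero_le
  set b := stdOrthonormalBasis ℝ V
  set y : Fin (Module.finrank ℝ V) → EuclideanSpace 𝕜 (Fin m) :=
    fun j => ((β⁻¹ : ℝ) : 𝕜) • app C (embed 𝕜 (b j)) with hydef
  have hysum : ∀ h : Fin (Module.finrank ℝ V) → ℝ, ∑ j, (h j : 𝕜) • y j
      = ((β⁻¹ : ℝ) : 𝕜) • app C (embed 𝕜 ((∑ j, h j • b j : V) : EuclideanSpace ℝ (Fin n))) := by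
    intro h
    rw [Submodule.coe_sum]
    simp_rw [Submodule.coe_smul]
    rw [embed_sum_smul, app_sum, Finset.smul_sum]
    refine Finset.sum_congr rfl fun j _ => ?_
    rw [hydef, app_smul, smul_comm]
  have hnorm : ∀ h : Fin (Module.finrank ℝ V) → ℝ,
      ‖((∑ j, h j • b j : V) : EuclideanSpace ℝ (Fin n))‖ ^ 2 = ∑ j, h j ^ 2 := by
    intro h
    have := b.sum_sq_norm_inner_right (∑ j, h j • b j)
    rw [← Submodule.coe_norm, ← this]
    refine Finset.sum_congr rfl fun j _ => ?_
    rw [b.orthonormal.inner_right_fintype, Real.norm_eq_abs, sq_abs]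
  have hy : ∀ h : Fin (Module.finrank ℝ V) → ℝ, ‖∑ j, (h j : 𝕜) • y j‖ ^ 2 ≤ ∑ j, h j ^ 2 := by
    intro h
    rw [← hnorm, hysum, norm_smul, RCLike.norm_ofReal, abs_of_pos (inv_pos.2 hβ)]
    refine pow_le_pow_left₀ (by positivity) ?_ 2
    rw [inv_mul_le_iff₀ hβ]
    exact hC _ (Submodule.coe_mem _)
  refine (measure_mono fun z hz => ?_).trans (measure_sqrt_sum_sq_ge_le y hy hτ)
  obtain ⟨u, hu, hlt⟩ := hz
  set X := fun j => RCLike.re (inner 𝕜 (y j) (WithLp.toLp 2 z)) with hX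
  change √(Module.finrank ℝ V : ℝ) + τ ≤ √(∑ j, X j ^ 2)
  by_contra! hcon
  set h := fun j => inner ℝ (b j) (⟨u, hu⟩ : V) with hh
  have hexp : (∑ j, h j • b j : V) = ⟨u, hu⟩ := b.sum_repr' ⟨u, hu⟩
  have hue : RCLike.re (inner 𝕜 (app C (embed 𝕜 u)) (WithLp.toLp 2 z)) = β * ∑ j, h j * X j := by
    have h1 := hysum h
    rw [hexp] at h1
    have h2 : app C (embed 𝕜 u) = (β : 𝕜) • ∑ j, (h j : 𝕜) • y j := by
      rw [h1, smul_smul, ← RCLike.ofReal_mul, mul_inv_cancel₀ hβ.ne', RCLike.ofReal_one, one_smul]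
    rw [h2, inner_smul_left, RCLike.conj_ofReal, RCLike.re_ofReal_mul, sum_inner, map_sum]
    congr 1
    refine Finset.sum_congr rfl fun j _ => ?_
    rw [inner_smul_left, RCLike.conj_ofReal, RCLike.re_ofReal_mul]
  have hun : √(∑ j, h j ^ 2) = ‖u‖ := by
    rw [← hnorm, hexp, Real.sqrt_sq (norm_nonneg _)]
  have hcs := Real.sum_mul_le_sqrt_mul_sqrt Finset.univ h X
  rw [hun] at hcs
  have hkl : √(Module.finrank ℝ V : ℝ) ≤ √(ℓ : ℝ) := Real.sqrt_le_sqrt (by exact_mod_cast hV)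
  rw [hue, mul_assoc, mul_lt_mul_iff_right₀ hβ] at hlt
  have : ‖u‖ * √(∑ j, X j ^ 2) ≤ ‖u‖ * (√ℓ + τ) :=
    mul_le_mul_of_nonneg_left (by linarith) (norm_nonneg _)
  linarith

/-- A uniform bound for `⟨C u, z⟩` over a union of `M` subspaces. -/
theorem measure_exists_iUnion_re_inner_gt_le (C : Matrix (Fin m) (Fin n) 𝕜) {M ℓ : ℕ}
    (U : Fin M → Submodule ℝ (EuclideanSpace ℝ (Fin n)))
    (hU : ∀ i, Module.finrank ℝ (U i) ≤ ℓ) {β : ℝ} (hβ : 0 ≤ β)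
    (hC : ∀ i, ∀ u ∈ U i, ‖app C (embed 𝕜 u)‖ ≤ β * ‖u‖) {t : ℝ} (ht : 0 < t) :
    Measure.pi (fun _ : Fin m => stdGaussianScalar 𝕜)
        {z | ∃ i, ∃ u ∈ U i, β * (√ℓ + √2 * (√(Real.log M) + t)) * ‖u‖ <
          RCLike.re (inner 𝕜 (app C (embed 𝕜 u)) (WithLp.toLp 2 z))}
      ≤ ENNReal.ofReal (Real.exp (-t ^ 2)) := by
  rw [Set.ofPred_exists]
  refine (measure_iUnion_fintype_le _ _).trans ((Finset.sum_le_sum fun i _ =>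
    measure_exists_re_inner_gt_le C (U i) (hU i) hβ (hC i)
      (τ := √2 * (√(Real.log M) + t)) (by positivity)).trans ?_)
  rw [Finset.sum_const, Finset.card_univ, Fintype.card_fin, nsmul_eq_mul,
    ← ENNReal.ofReal_natCast, ← ENNReal.ofReal_mul (by positivity)]
  refine ENNReal.ofReal_le_ofReal ?_
  rcases Nat.eq_zero_or_pos M with rfl | hM
  · simp [(Real.exp_pos _).le]
  have hM1 : (1 : ℝ) ≤ M := by exact_mod_cast hM
  have hlog : 0 ≤ Real.log M := Real.log_nonneg hM1
  calc (M : ℝ) * Real.exp (-(√2 * (√(Real.log M) + t)) ^ 2 / 2)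
      = Real.exp (Real.log M + -(√2 * (√(Real.log M) + t)) ^ 2 / 2) := by
        rw [Real.exp_add, Real.exp_log (by positivity)]
    _ ≤ Real.exp (-t ^ 2) := by
        -- With a = √(log M), the claim is (a + t)² ≥ a² + t²; the a² absorbs the M terms of the
        -- union bound.
        refine Real.exp_le_exp.2 ?_
        have h1 := Real.sq_sqrt hlog
        have h2 := Real.sq_sqrt (show (0 : ℝ) ≤ 2 by norm_num)
        have h3 : 0 ≤ √(Real.log M) * t := by positivity
        rw [neg_div, mul_pow, h2]
        nlinarith

theorem IsStdGaussianVector.hasLaw {Ω : Type*} [MeasurableSpace Ω] {P : Measure Ω}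
    [IsProbabilityMeasure P] {g : Ω → EuclideanSpace 𝕜 (Fin m)} (hg : IsStdGaussianVector g P) :
    HasLaw (fun ω i => g ω i) (Measure.pi fun _ : Fin m => stdGaussianScalar 𝕜) P where
  aemeasurable := aemeasurable_pi_lambda _ fun i => (hg.1 i).aemeasurable
  map_eq := by
    rw [(iIndepFun_iff_map_fun_eq_pi_map fun i => (hg.1 i).aemeasurable).1 hg.2]
    simp_rw [(hg.1 _).map_eq]

/-- The exceptional set of a random vector has at most the measure it has under the law. -/
theorem exists_measurableSet_of_hasLaw {Ω X : Type*} [MeasurableSpace Ω] [MeasurableSpace X]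
    {P : Measure Ω} [IsProbabilityMeasure P] {μ : Measure X} {f : Ω → X} (hf : HasLaw f μ P)
    {s : Set X} {q : ℝ} (hq : 0 ≤ q) (hs : μ s ≤ ENNReal.ofReal q) :
    ∃ A : Set Ω, MeasurableSet A ∧ 1 - q ≤ P.real A ∧ ∀ ω ∈ A, f ω ∉ s := by
  -- Since s need not be measurable, its measurable hull transports the bound to P.
  have hP : P (f ⁻¹' s) ≤ ENNReal.ofReal q :=
    calc P (f ⁻¹' s) ≤ P (f ⁻¹' toMeasurable μ s) :=
          measure_mono (Set.preimage_mono (subset_toMeasurable μ s))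
      _ = μ (toMeasurable μ s) := by
          rw [← hf.map_eq, Measure.map_apply_of_aemeasurable hf.aemeasurable
            (measurableSet_toMeasurable _ _)]
      _ ≤ ENNReal.ofReal q := by rwa [measure_toMeasurable]
  refine ⟨(toMeasurable P (f ⁻¹' s))ᶜ, (measurableSet_toMeasurable _ _).compl, ?_,
    fun ω hω h => hω (subset_toMeasurable _ _ h)⟩
  rw [probReal_compl_eq_one_sub (measurableSet_toMeasurable _ _), measureReal_def,
    measure_toMeasurable]
  have := ENNReal.toReal_le_of_le_ofReal hq hP
  linarith

end Noise

/-! ### Deterministic part of the recovery estimate. -/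

section Recovery

variable {𝕜 : Type*} [RCLike 𝕜] {m n : ℕ}

/-- Since D̃S = SD, the preconditioned signal cancels against the model and only the error and the
noise remain. -/
theorem objective_measurements {S : Matrix (Fin m) (Fin n) ℝ} (hS : IsSamplingMatrix S)
    (F : Matrix (Fin n) (Fin n) 𝕜) (d : Fin n → ℝ) (σ : ℝ) (x₀ x : EuclideanSpace ℝ (Fin n))
    (g : EuclideanSpace 𝕜 (Fin m)) :
    objective S F d (measurements S F σ x₀ g) x
      = ‖app (realMat 𝕜 (S * Matrix.diagonal d) * F) (embed 𝕜 (x - x₀))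
          - ((σ / √m : ℝ) : 𝕜) • app (realMat 𝕜 (precond S d)) g‖ ^ 2 := by
  rw [objective, measurements, app_add, app_smul, ← app_mul, ← Matrix.mul_assoc, ← realMat_mul,
    precond_mul hS, embed_sub, app_sub]
  congr 2
  abel

theorem norm_sq_le_of_norm_sub_sq_le {E : Type*} [SeminormedAddCommGroup E]
    [InnerProductSpace 𝕜 E] {y z : E} {ε : ℝ} (h : ‖y - z‖ ^ 2 ≤ ‖z‖ ^ 2 + ε) :
    ‖y‖ ^ 2 ≤ 2 * RCLike.re (inner 𝕜 y z) + ε := by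
  have := norm_sub_sq (𝕜 := 𝕜) y z
  linarith

/-- If y - 2q exceeded √ε, so would y, and y(y - 2q) would exceed ε. -/
theorem le_two_mul_add_sqrt_of_sq_le {y q ε : ℝ} (hq : 0 ≤ q) (hε : 0 ≤ ε)
    (h : y ^ 2 ≤ 2 * y * q + ε) : y ≤ 2 * q + √ε := by
  by_contra! hlt
  have h0 := Real.sqrt_nonneg ε
  have h1 := Real.sq_sqrt hε
  nlinarith [mul_pos (sub_pos.2 hlt) (show 0 < y by linarith), mul_nonneg hq h0]

end Recovery

end SubsampledUnitary

theorem mainTheorem4 {𝕜 : Type*} [RCLike 𝕜] {m n M ℓ : ℕ}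
    -- prior set, contained up to differences in a union of `M` subspaces of dimension at most `ℓ`
    (Q T : Set (EuclideanSpace ℝ (Fin n)))
    (U : Fin M → Submodule ℝ (EuclideanSpace ℝ (Fin n)))
    (hU : ∀ i, Module.finrank ℝ (U i) ≤ ℓ)
    (hT : T = ⋃ i, (U i : Set (EuclideanSpace ℝ (Fin n))))
    (hQT : Q - Q ⊆ T)
    -- unitary matrix, deterministic sampling matrix, preconditioning vector
    (F : Matrix (Fin n) (Fin n) 𝕜) (hF : F ∈ Matrix.unitaryGroup (Fin n) 𝕜)
    (S : Matrix (Fin m) (Fin n) ℝ) (hS : SubsampledUnitary.IsSamplingMatrix S)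
    (d : Fin n → ℝ) (hd : ∀ j, 0 ≤ d j)
    (hRIP : SubsampledUnitary.HasRIP
      (SubsampledUnitary.realMat 𝕜 (S * Matrix.diagonal d) * F) T)
    (hSd : Antitone (S.mulVec d))
    -- Gaussian noise
    {Ω : Type*} [MeasurableSpace Ω] (P : Measure Ω) [IsProbabilityMeasure P]
    (g : Ω → EuclideanSpace 𝕜 (Fin m)) (hg : SubsampledUnitary.IsStdGaussianVector g P)
    (σ : ℝ) (hσ : 0 ≤ σ) (t : ℝ) (ht : 0 < t) :
    ∃ A : Set Ω, MeasurableSet A ∧ 1 - 2 * Real.exp (-t ^ 2) ≤ P.real A ∧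
      ∀ ω ∈ A, ∀ x₀ p : EuclideanSpace ℝ (Fin n), SubsampledUnitary.IsNearestPoint Q x₀ p →
        ∀ ε : ℝ, 0 < ε → ∀ xhat : EuclideanSpace ℝ (Fin n),
          SubsampledUnitary.IsApproxMinimizer Q S F d
            (SubsampledUnitary.measurements S F σ x₀ (g ω)) ε xhat →
          ‖xhat - x₀‖ ≤
            9 * (σ / Real.sqrt m)
                * ‖SubsampledUnitary.app (SubsampledUnitary.precond S d)
                    (SubsampledUnitary.unitTrunc
                      ((S * Matrix.diagonal d).mulVec (SubsampledUnitary.localCoherences F T)))‖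
                * (Real.sqrt ℓ + Real.sqrt (Real.log M) + t)
              + ‖x₀ - p‖
              + 6 * ‖SubsampledUnitary.app (SubsampledUnitary.realMat 𝕜 (S * Matrix.diagonal d) * F)
                  (SubsampledUnitary.embed 𝕜 (x₀ - p))‖
              + 3 / 2 * Real.sqrt ε := by
  open SubsampledUnitary in
  have hTcone : ∀ c : ℝ, ∀ u ∈ T, c • u ∈ T := by
    subst hT
    intro c u hu
    obtain ⟨i, hi⟩ := Set.mem_iUnion.1 hu
    exact Set.mem_iUnion.2 ⟨i, (U i).smul_mem c hi⟩
  set B := ‖app (precond S d)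
    (unitTrunc ((S * Matrix.diagonal d).mulVec (localCoherences F T)))‖ with hB
  set A := realMat 𝕜 (S * Matrix.diagonal d) * F with hA
  set W := realMat 𝕜 (precond S d) with hW
  set s := σ / √(m : ℝ) with hs
  have hB0 : 0 ≤ B := norm_nonneg _
  have hs0 : 0 ≤ s := by positivity
  have hWA : ∀ i, ∀ u ∈ U i, ‖app (W * A) (embed 𝕜 u)‖ ≤ 4 / 3 * B * ‖u‖ := by
    intro i u hu
    rw [app_mul]
    exact norm_app_precond_app_le hTcone F hS hd hRIP hSd (hT ▸ Set.mem_iUnion.2 ⟨i, hu⟩)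
  obtain ⟨G, hGm, hGP, hG⟩ := exists_measurableSet_of_hasLaw hg.hasLaw (Real.exp_pos _).le
    (measure_exists_iUnion_re_inner_gt_le (W * A) U hU (by positivity) hWA ht)
  refine ⟨G, hGm, by linarith [Real.exp_pos (-t ^ 2)], ?_⟩
  intro ω hω x₀ p hp ε hε xhat hx
  set w := xhat - p with hw
  have hwT : w ∈ T := hQT (Set.sub_mem_sub hx.1 hp.1)
  set η := (s : 𝕜) • app W (g ω) with hη
  set q := ‖app A (embed 𝕜 (x₀ - p))‖ with hq
  set N := 4 / 3 * B * (√ℓ + √2 * (√(Real.log M) + t)) with hN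
  have hnoise : RCLike.re (inner 𝕜 (app A (embed 𝕜 w)) η) ≤ s * (N * ‖w‖) := by
    -- D̃ is real diagonal, hence self-adjoint, and moves from the noise onto Aw.
    rw [hη, inner_smul_right, RCLike.re_ofReal_mul, hW, precond, inner_app_realMat_diagonal]
    refine mul_le_mul_of_nonneg_left ?_ hs0
    rw [← app_mul]
    by_contra! hlt
    obtain ⟨i, hi⟩ := Set.mem_iUnion.1 (hT ▸ hwT)
    exact hG ω hω ⟨i, w, hi, hlt⟩
  have hopt := hx.2 p hp.1
  rw [objective_measurements hS, objective_measurements hS,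
    show xhat - x₀ = w - (x₀ - p) by rw [hw]; abel, embed_sub, app_sub,
    show p - x₀ = -1 • (x₀ - p) by simp] at hopt
  rw [show -1 • (x₀ - p) = (-1 : ℝ) • (x₀ - p) by simp, embed_smul, app_smul] at hopt
  set Aw := app A (embed 𝕜 w) with hAw
  set Ax := app A (embed 𝕜 (x₀ - p)) with hAx
  have hsq : ‖Aw‖ ^ 2 ≤ 2 * RCLike.re (inner 𝕜 Aw (Ax + η)) + ε := by
    refine norm_sq_le_of_norm_sub_sq_le ?_
    have h1 : Aw - Ax - η = Aw - (Ax + η) := by abel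
    have h2 : ((-1 : ℝ) : 𝕜) • Ax - η = -(Ax + η) := by
      simp only [RCLike.ofReal_neg, RCLike.ofReal_one, neg_smul, one_smul]; abel
    rw [← h1, ← norm_neg (Ax + η), ← h2]
    exact hopt
  rw [inner_add_right, map_add] at hsq
  have hCS : RCLike.re (inner 𝕜 Aw Ax) ≤ ‖Aw‖ * q := re_inner_le_norm _ _
  have hlow := (hRIP.bounds hTcone hwT).1
  have hN0 : 0 ≤ N := by positivity
  have hsN : s * (N * ‖w‖) ≤ ‖Aw‖ * (3 / 2 * (s * N)) := by
    have := mul_le_mul_of_nonneg_left hlow (mul_nonneg hs0 hN0)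
    linarith
  have hq0 : 0 ≤ q := norm_nonneg _
  have hy : ‖Aw‖ ≤ 2 * (q + 3 / 2 * (s * N)) + √ε :=
    le_two_mul_add_sqrt_of_sq_le (by positivity) hε.le (by linarith)
  have htri : ‖xhat - x₀‖ ≤ ‖w‖ + ‖x₀ - p‖ := by
    rw [show xhat - x₀ = w - (x₀ - p) by rw [hw]; abel]
    exact norm_sub_le _ _
  -- Here 2 = 4/3 · 3/2, using √2 ≤ 3/2. Then ‖w‖ ≤ 3/2 ‖Aw‖ ≤ 3q + 9/2 sN + 3/2 √ε yields the
  -- constant 9, and 3q is within the allowed 6q.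
  have hNle : N ≤ 2 * B * (√ℓ + √(Real.log M) + t) := by
    have h2 : √2 ≤ 3 / 2 := by
      rw [Real.sqrt_le_left (by norm_num)]; norm_num
    have h3 : √2 * (√(Real.log M) + t) ≤ 3 / 2 * (√(Real.log M) + t) :=
      mul_le_mul_of_nonneg_right h2 (by positivity)
    have h4 : √ℓ + √2 * (√(Real.log M) + t) ≤ 3 / 2 * (√ℓ + √(Real.log M) + t) := by
      linarith [Real.sqrt_nonneg (ℓ : ℝ)]
    have := mul_le_mul_of_nonneg_left h4 (show 0 ≤ 4 / 3 * B by positivity)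
    rw [hN]
    linarith
  have hsNle := mul_le_mul_of_nonneg_left hNle hs0
  linarith
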